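/- Let $m\ge 1$ be an integer. For $n\ge 0$ let $H_n=\sum_{k=1}^n \frac1k$ and $H_n^{(2)}=\sum_{k=1}^n\frac1{k^2}$ (so $H_0=H_0^{(2)}=0$), let $\zeta$ be the Riemann zeta function, and let $$F_3(0,m)=\frac{\partial^3}{\partial x^3}\left\{\frac{\partial^m}{\partial z^m}\frac{\Gamma(x+1)\Gamma(z)}{\Gamma(x+z)}\right\}\bigg|_{x=0,\;z=1},$$ the partial derivatives being taken in real variables $x,z$. Empty sums are $0$. Then both series below converge, and $$\sum_{k=0}^{\infty}\frac{H_k^2-H_k^{(2)}}{(k+1)^{m+1}}=\frac{(-1)^m}{3\,m!}F_3(0,m)$$ $$=\frac{(m+1)(m+2)}{3}\zeta(m+3)-\sum_{j=1}^{m-1}(j+1)\zeta(j+2)\zeta(m+1-j)+\frac1m\sum_{\ell=1}^{m-1}(m-\ell)\zeta(m-\ell+1)\sum_{j=1}^{\ell-1}\zeta(j+1)\zeta(\ell-j+1).$$ Also $$\sum_{k=1}^{\infty}\frac{H_k^2-H_k^{(2)}}{k^{m+1}}=\frac{(-1)^m}{3\,m!}F_3(0,m)+(m+2)\zeta(m+3)-\sum_{j=1}^{m}\zeta(j+1)\zeta(m+2-j)$$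 $$=\frac{(m+2)(m+4)}{3}\zeta(m+3)-\zeta(2)\zeta(m+1)-2\sum_{j=2}^{m}\zeta(j+1)\zeta(m+2-j)-\sum_{j=1}^{m-1}j\,\zeta(j+2)\zeta(m+1-j)$$ $$+\frac1m\sum_{\ell=1}^{m-1}(m-\ell)\zeta(m-\ell+1)\sum_{j=1}^{\ell-1}\zeta(j+1)\zeta(\ell-j+1).$$ -/

import Mathlib

/-- The generalized harmonic number `H_n^{(s)} = ∑_{k=1}^n 1 / k^s` of order `s`.
For `s = 1` this is Mathlib's `harmonic n`. -/
def genHarmonic (s n : ℕ) : ℚ := ∑ k ∈ Finset.Icc 1 n, 1 / (k : ℚ) ^ s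

theorem genHarmonic_one (n : ℕ) : genHarmonic 1 n = harmonic n := by
  simp [genHarmonic, harmonic_eq_sum_Icc]

/-- `F₃(n, m) = ∂³/∂x³ { ∂ᵐ/∂zᵐ Γ(x+1) Γ(z) / Γ(x+z) }` at `x = n`, `z = 1`
(real partial derivatives). -/
noncomputable def F₃ (n m : ℕ) : ℝ :=
  iteratedDeriv 3
    (fun x : ℝ => iteratedDeriv m
      (fun z : ℝ => Real.Gamma (x + 1) * Real.Gamma z / Real.Gamma (x + z)) 1) n

/-!
Let `G(x, z) = Γ(x + 1) Γ(z) / Γ(x + z)`. Both the two series and the zeta values are read off from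
the Taylor coefficients of `G` at `(x, z) = (0, 1)`, which are computed in two ways.

On the one hand, for `0 < x < 1` the Beta integral and the binomial series give
`G(x, z) = ∑ₖ x ∏_{i ≤ k} (1 - x / i) / (k + z)` (`hasSum_gammaQuotient`). Expanding first in `z - 1`
and then in `x`, the coefficients become, up to sign, the sums `∑ₖ eₙ(1, …, 1/k) / (k + 1) ^ (m + 1)`
with `eₙ` the elementary symmetric polynomials (`hasSum_taylorCoeff`). For `n = 1` and `n = 2` these
are the sums of `Hₖ / (k + 1) ^ (m + 1)` and of `(Hₖ² - Hₖ⁽²⁾) / (2 (k + 1) ^ (m + 1))`.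

On the other hand, `∂G/∂z = G · (ψ(z) - ψ(x + z))` with `ψ` the digamma function, and
`ψ⁽ⁿ⁾(1) = (-1)ⁿ⁺¹ n! ζ(n + 1)`, which follows from `ψ(x + 1) = ψ(x) + 1 / x` and the monotonicity of
`ψ` (`iteratedDeriv_realDigamma_one`). Leibniz' rule turns this into a recurrence for the Taylor
coefficients with zeta values as coefficients (`taylorCoeff_succ`). Solving it for the powers `x²` and
`x³`, with a symmetrization of the finite sums, gives Euler's formula for the linear sums
(`two_mul_neg_taylorCoeff_two`) and the closed form of the quadratic sums
(`two_mul_neg_taylorCoeff_three`). The recurrence also shows, by induction, that `∂ᵐG/∂zᵐ (x, 1)` is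
analytic at `x = 0`, so that the expansion valid for `x > 0` determines its derivatives at `0`.
-/

open Filter Topology Finset MeasureTheory

/-! ### Taylor coefficients of a double series; the digamma function -/

/-- Rearrangement of an absolutely summable double series: if `f y = ∑ₖ ∑ⱼ a k j * y ^ j` near `0`,
then the `n`-th Taylor coefficient of `f` at `0` is `∑ₖ a k n`. -/
theorem analyticAt_and_hasSum_iteratedDeriv {a : ℕ → ℕ → ℝ} {r : ℝ} (hr : 0 < r)
    (hs : Summable fun p : ℕ × ℕ => |a p.1 p.2| * r ^ p.2) {F : ℕ → ℝ → ℝ} {f : ℝ → ℝ}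
    (hF : ∀ k y, |y| < r → HasSum (fun j => a k j * y ^ j) (F k y))
    (hf : ∀ y, |y| < r → HasSum (fun k => F k y) (f y)) :
    AnalyticAt ℝ f 0 ∧ ∀ n, HasSum (fun k => a k n) (iteratedDeriv n f 0 / n.factorial) := by
  have hcol : ∀ j, Summable fun k => a k j := by
    intro j
    have h1 : Summable fun k => |a k j| * r ^ j :=
      hs.comp_injective (i := fun k : ℕ => (k, j)) fun k l h => by simpa using h
    have h2 : Summable fun k => |a k j| := by
      refine (h1.mul_right ((r ^ j)⁻¹)).congr fun k => ?_
      field_simp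
    exact h2.of_abs
  have hdouble : ∀ y, |y| < r → Summable fun p : ℕ × ℕ => a p.1 p.2 * y ^ p.2 := by
    intro y hy
    refine Summable.of_norm_bounded hs fun p => ?_
    rw [Real.norm_eq_abs, abs_mul, abs_pow]
    gcongr
  set c : ℕ → ℝ := fun j => ∑' k, a k j with hc
  have hsumf : ∀ y, |y| < r → HasSum (fun j => c j * y ^ j) (f y) := by
    intro y hy
    have h := (hdouble y hy).hasSum
    have h1 := (h.prod_fiberwise fun k => hF k y hy).unique (hf y hy)
    rw [← h1]
    -- Sum the same double series in the other order.
    have h2 : HasSum (fun p : ℕ × ℕ => a p.2 p.1 * y ^ p.1)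
        (∑' p : ℕ × ℕ, a p.1 p.2 * y ^ p.2) := (Equiv.prodComm ℕ ℕ).hasSum_iff.mpr h
    exact h2.prod_fiberwise fun j => (hcol j).hasSum.mul_right _
  have hps : HasFPowerSeriesOnBall f (FormalMultilinearSeries.ofScalars ℝ c) 0
      (ENNReal.ofReal r) := by
    refine ⟨?_, by simpa using hr, ?_⟩
    · refine ENNReal.le_of_forall_pos_nnreal_lt fun q _ hq => ?_
      have hq' : (q : ℝ) < r := by
        rwa [← ENNReal.ofReal_coe_nnreal, ENNReal.ofReal_lt_ofReal_iff hr] at hq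
      refine FormalMultilinearSeries.le_radius_of_summable_norm _ ?_
      have := (hsumf q (by simpa using hq')).summable.norm
      refine this.congr fun n => ?_
      rw [FormalMultilinearSeries.ofScalars_norm]
      simp
    · intro y hy
      have hy' : |y| < r := by
        rw [Metric.eball_ofReal] at hy
        simpa using hy
      simpa [mul_comm] using hsumf y hy'
  refine ⟨hps.analyticAt, fun n => ?_⟩
  have h := hps.hasFPowerSeriesAt.eq_formalMultilinearSeries hps.analyticAt.hasFPowerSeriesAt
  have h' := congrFun (FormalMultilinearSeries.ofScalars_series_injective ℝ ℝ h) n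
  rw [← h']
  exact (hcol n).hasSum

theorem analyticAt_Gamma_of_pos {x : ℝ} (hx : 0 < x) : AnalyticAt ℝ Real.Gamma x := by
  have h : AnalyticAt ℂ Complex.Gamma x := by
    rw [Complex.analyticAt_iff_eventually_differentiableAt]
    have : ∀ᶠ s : ℂ in 𝓝 (x : ℂ), 0 < s.re :=
      (isOpen_lt continuous_const Complex.continuous_re).mem_nhds (by simpa using hx)
    filter_upwards [this] with s hs
    refine Complex.differentiableAt_Gamma _ fun m hm => ?_
    rw [hm] at hs
    simp at hs
    linarith [(Nat.cast_nonneg m : (0 : ℝ) ≤ m)]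
  exact h.re_ofReal

/-- The real digamma function `ψ = Γ' / Γ`. Only its values on `(0, ∞)` are used. -/
noncomputable def realDigamma : ℝ → ℝ := logDeriv Real.Gamma

theorem analyticAt_realDigamma {x : ℝ} (hx : 0 < x) : AnalyticAt ℝ realDigamma x :=
  (analyticAt_Gamma_of_pos hx).deriv.div (analyticAt_Gamma_of_pos hx) (Real.Gamma_pos_of_pos hx).ne'

theorem deriv_Gamma_of_pos {x : ℝ} (hx : 0 < x) :
    deriv Real.Gamma x = Real.Gamma x * realDigamma x := by
  have := (Real.Gamma_pos_of_pos hx).ne'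
  rw [realDigamma, logDeriv_apply]
  field_simp

theorem realDigamma_add_one {x : ℝ} (hx : 0 < x) : realDigamma (x + 1) = realDigamma x + 1 / x := by
  have hx1 : 0 < x + 1 := by linarith
  have h1 : HasDerivAt (fun y => Real.Gamma (y + 1)) (deriv Real.Gamma (x + 1)) x :=
    (analyticAt_Gamma_of_pos hx1).differentiableAt.hasDerivAt.comp_add_const x 1
  have h2 : HasDerivAt (fun y => y * Real.Gamma y)
      (1 * Real.Gamma x + x * deriv Real.Gamma x) x :=
    (hasDerivAt_id x).mul (analyticAt_Gamma_of_pos hx).differentiableAt.hasDerivAt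
  have h3 : (fun y => Real.Gamma (y + 1)) =ᶠ[𝓝 x] fun y => y * Real.Gamma y := by
    filter_upwards [lt_mem_nhds hx] with y hy
    exact Real.Gamma_add_one hy.ne'
  have h4 := h1.unique (h2.congr_of_eventuallyEq h3)
  have hG := (Real.Gamma_pos_of_pos hx).ne'
  rw [realDigamma, logDeriv_apply, logDeriv_apply, h4, Real.Gamma_add_one hx.ne']
  field_simp
  ring

theorem realDigamma_add_nat {x : ℝ} (hx : 0 < x) (N : ℕ) :
    realDigamma (x + N) = realDigamma x + ∑ k ∈ range N, 1 / (x + k) := by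
  induction N with
  | zero => simp
  | succ N ih =>
    rw [sum_range_succ, ← add_assoc, ← ih, Nat.cast_add, Nat.cast_one, ← add_assoc,
      realDigamma_add_one (by positivity)]

/-- `ψ` is the derivative of the convex function `log Γ`. -/
theorem monotoneOn_realDigamma : MonotoneOn realDigamma (Set.Ioi 0) := by
  have hd : ∀ x ∈ Set.Ioi (0 : ℝ), HasDerivAt (Real.log ∘ Real.Gamma) (realDigamma x) x :=
    fun x hx => (analyticAt_Gamma_of_pos hx).differentiableAt.hasDerivAt.log
      (Real.Gamma_pos_of_pos hx).ne'
  refine (Real.convexOn_log_Gamma.monotoneOn_deriv fun x hx => (hd x hx).differentiableAt).congr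
    fun x hx => (hd x hx).deriv

/-- By monotonicity `ψ(1 + y + N)` lies between `ψ(N)` and `ψ(N + 2)`, which differ from `ψ(N + 1)`
by at most `1 / N`. -/
theorem tendsto_realDigamma_sub {y : ℝ} (hy : |y| < 1) :
    Tendsto (fun N : ℕ => realDigamma (1 + y + N) - realDigamma (1 + N)) atTop (𝓝 0) := by
  obtain ⟨hy1, hy2⟩ := abs_lt.mp hy
  have hlim : Tendsto (fun N : ℕ => 1 / (N : ℝ)) atTop (𝓝 0) := tendsto_one_div_atTop_nhds_zero_nat
  refine squeeze_zero_norm' ?_ hlim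
  filter_upwards [eventually_gt_atTop 0] with N hN
  have hN' : (0 : ℝ) < N := by exact_mod_cast hN
  have e1 := realDigamma_add_one hN'
  have e2 := realDigamma_add_one (x := 1 + N) (by positivity)
  have m1 := monotoneOn_realDigamma (a := N) (b := 1 + y + N) hN'
    (by simp only [Set.mem_Ioi]; linarith) (by linarith)
  have m2 := monotoneOn_realDigamma (a := 1 + y + N) (b := 1 + N + 1)
    (by simp only [Set.mem_Ioi]; linarith) (by simp only [Set.mem_Ioi]; linarith) (by linarith)
  have h3 : 1 / (1 + N : ℝ) ≤ 1 / N := by gcongr; linarith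
  rw [add_comm (N : ℝ) 1] at e1
  rw [Real.norm_eq_abs, abs_le]
  constructor <;> linarith

theorem hasSum_realDigamma {y : ℝ} (hy : |y| < 1 / 2) :
    HasSum (fun k : ℕ => 1 / ((k : ℝ) + 1) - 1 / (k + 1 + y))
      (realDigamma (1 + y) - realDigamma 1) := by
  obtain ⟨hy1, hy2⟩ := abs_lt.mp hy
  have hs : Summable fun k : ℕ => 1 / ((k : ℝ) + 1) - 1 / (k + 1 + y) := by
    have h2 : Summable fun k : ℕ => 1 / ((k : ℝ) + 1) ^ 2 := by
      exact_mod_cast (summable_nat_add_iff 1).mpr (Real.summable_one_div_nat_pow.mpr one_lt_two)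
    refine Summable.of_norm_bounded h2 fun k => ?_
    have hk : (0 : ℝ) ≤ k := Nat.cast_nonneg k
    have hpos : 0 < (k : ℝ) + 1 + y := by linarith
    rw [show 1 / ((k : ℝ) + 1) - 1 / (k + 1 + y) = y / ((k + 1) * (k + 1 + y)) by
      field_simp; ring, norm_div, Real.norm_eq_abs, Real.norm_eq_abs,
      abs_of_pos (by positivity : 0 < ((k : ℝ) + 1) * (k + 1 + y)),
      div_le_div_iff₀ (by positivity) (by positivity)]
    have : |y| * (k + 1) ≤ k + 1 + y := by nlinarith
    nlinarith
  refine (hs.hasSum_iff_tendsto_nat).mpr ?_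
  have h := (tendsto_realDigamma_sub (y := y) (by linarith)).const_sub
    (realDigamma (1 + y) - realDigamma 1)
  rw [sub_zero] at h
  refine h.congr fun N => ?_
  rw [realDigamma_add_nat (by linarith), realDigamma_add_nat one_pos, sum_sub_distrib]
  have e1 : ∀ k : ℕ, 1 / ((k : ℝ) + 1) = 1 / (1 + (k : ℝ)) := fun k => by rw [add_comm]
  have e2 : ∀ k : ℕ, 1 / ((k : ℝ) + 1 + y) = 1 / (1 + y + (k : ℝ)) := fun k => by
    rw [add_comm (k : ℝ) 1, add_right_comm]
  simp only [e1, e2]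
  ring

theorem hasSum_geometric_inv_add (k : ℕ) {y : ℝ} (hy : |y| < 1 / 2) :
    HasSum (fun j : ℕ => (-1) ^ j / ((k : ℝ) + 1) ^ (j + 1) * y ^ j) (1 / (k + 1 + y)) := by
  have hk : (1 : ℝ) ≤ k + 1 := by linarith [(Nat.cast_nonneg k : (0 : ℝ) ≤ k)]
  have hlt : |-y / (k + 1)| < 1 := by
    rw [abs_div, abs_neg, abs_of_pos (by linarith : (0 : ℝ) < k + 1), div_lt_one (by linarith)]
    linarith
  obtain ⟨hy1, hy2⟩ := abs_lt.mp hy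
  have hne : (k : ℝ) + 1 + y ≠ 0 := by linarith
  have hsum := (hasSum_geometric_of_abs_lt_one hlt).mul_left (1 / ((k : ℝ) + 1))
  have hval : 1 / ((k : ℝ) + 1) * (1 - -y / (k + 1))⁻¹ = 1 / (k + 1 + y) := by
    rw [show 1 - -y / ((k : ℝ) + 1) = (k + 1 + y) / (k + 1) by field_simp; ring]
    field_simp
  rw [hval] at hsum
  refine hsum.congr_fun fun j => ?_
  rw [div_pow, neg_pow y, pow_succ]
  field_simp

/-- The domination used to apply `analyticAt_and_hasSum_iteratedDeriv` with `r = 1 / 2`. -/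
theorem summable_geometric_half_mul {b : ℕ → ℝ} (hb : Summable b) (hb0 : ∀ k, 0 ≤ b k)
    {a : ℕ → ℕ → ℝ} (ha : ∀ k j, |a k j| ≤ b k) :
    Summable fun p : ℕ × ℕ => |a p.1 p.2| * (1 / 2 : ℝ) ^ p.2 := by
  refine Summable.of_nonneg_of_le (fun p => by positivity) (fun p => ?_)
    (hb.mul_of_nonneg summable_geometric_two hb0 fun j => by positivity)
  exact mul_le_mul_of_nonneg_right (ha p.1 p.2) (by positivity)

/-- The polygamma values `ψ⁽ⁿ⁾(1) = (-1)ⁿ⁺¹ n! ζ(n + 1)`, in the form of a series. -/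
theorem hasSum_iteratedDeriv_realDigamma {n : ℕ} (hn : n ≠ 0) :
    HasSum (fun k : ℕ => (-1) ^ (n + 1) / ((k : ℝ) + 1) ^ (n + 1))
      (iteratedDeriv n realDigamma 1 / n.factorial) := by
  have h2 : Summable fun k : ℕ => 1 / ((k : ℝ) + 1) ^ 2 := by
    exact_mod_cast (summable_nat_add_iff 1).mpr (Real.summable_one_div_nat_pow.mpr one_lt_two)
  -- The Taylor coefficients of `1 / (k + 1) - 1 / (k + 1 + y)`; the two constant terms cancel.
  let a : ℕ → ℕ → ℝ := fun k j =>
    (if j = 0 then 1 / ((k : ℝ) + 1) else 0) - (-1) ^ j / ((k : ℝ) + 1) ^ (j + 1)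
  have key := analyticAt_and_hasSum_iteratedDeriv (a := a) (r := 1 / 2) (by norm_num)
    (F := fun k y => 1 / ((k : ℝ) + 1) - 1 / (k + 1 + y))
    (f := fun y => realDigamma (1 + y) - realDigamma 1)
    (summable_geometric_half_mul h2 (fun k => by positivity) fun k j => ?_)
    (fun k y hy => ?_) (fun y hy => hasSum_realDigamma hy)
  · have h := key.2 n
    simp only [a, hn, if_false, zero_sub] at h
    have han : AnalyticAt ℝ (fun y : ℝ => realDigamma (1 + y)) 0 :=
      (analyticAt_realDigamma one_pos).comp_of_eq (analyticAt_const.add analyticAt_id) (by simp)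
    rw [iteratedDeriv_fun_sub han.contDiffAt contDiffAt_const,
      iteratedDeriv_comp_const_add, iteratedDeriv_const, if_neg hn, sub_zero] at h
    simp only [add_zero] at h
    refine h.congr_fun fun k => ?_
    rw [pow_succ]; ring
  · rcases j with _ | j
    · simp [a]; positivity
    · simp only [a, Nat.succ_ne_zero, if_false, zero_sub, abs_neg, abs_div, abs_pow, abs_one, one_pow]
      have hk : (1 : ℝ) ≤ k + 1 := by linarith [(Nat.cast_nonneg k : (0 : ℝ) ≤ k)]
      rw [abs_of_pos (by linarith : (0 : ℝ) < k + 1)]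
      gcongr 1 / ?_
      exact pow_le_pow_right₀ hk (by omega)
  · have h0 : HasSum (fun j => (if j = 0 then 1 / ((k : ℝ) + 1) else 0) * y ^ j)
        (1 / ((k : ℝ) + 1)) := by
      refine (hasSum_ite_eq 0 (1 / ((k : ℝ) + 1))).congr_fun fun j => ?_
      by_cases h : j = 0 <;> simp [h]
    refine (h0.sub (hasSum_geometric_inv_add k hy)).congr_fun fun j => ?_
    simp only [a]; ring

/-! ### Differentiating the Gamma quotient through the digamma function -/

/-- The function `z ↦ Γ(x + 1) Γ(z) / Γ(x + z)` with parameter `x`. -/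
noncomputable def gammaQuotient (x z : ℝ) : ℝ :=
  Real.Gamma (x + 1) * Real.Gamma z / Real.Gamma (x + z)

/-- The `m`-th partial derivative in `z`, at `z = 1`, of `Γ(x + 1) Γ(z) / Γ(x + z)`, as a function
of `x`. -/
noncomputable def gammaQuotientDeriv (m : ℕ) (x : ℝ) : ℝ := iteratedDeriv m (gammaQuotient x) 1

theorem analyticAt_gammaQuotient {x z : ℝ} (hz : 0 < z) (hxz : 0 < x + z) :
    AnalyticAt ℝ (gammaQuotient x) z := by
  have h : AnalyticAt ℝ (fun z => Real.Gamma (x + z)) z :=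
    (analyticAt_Gamma_of_pos hxz).comp (analyticAt_const.add analyticAt_id)
  exact (analyticAt_const.mul (analyticAt_Gamma_of_pos hz)).div h (Real.Gamma_pos_of_pos hxz).ne'

theorem deriv_gammaQuotient {x z : ℝ} (hz : 0 < z) (hxz : 0 < x + z) :
    deriv (gammaQuotient x) z = gammaQuotient x z * (realDigamma z - realDigamma (x + z)) := by
  have h1 := (analyticAt_Gamma_of_pos hz).differentiableAt.hasDerivAt
  have h2 : HasDerivAt (fun z => Real.Gamma (x + z)) (deriv Real.Gamma (x + z)) z :=
    (analyticAt_Gamma_of_pos hxz).differentiableAt.hasDerivAt.comp_const_add x z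
  have hne := (Real.Gamma_pos_of_pos hxz).ne'
  have h3 := ((h1.const_mul (Real.Gamma (x + 1))).div h2 hne).deriv
  refine h3.trans ?_
  rw [deriv_Gamma_of_pos hz, deriv_Gamma_of_pos hxz, gammaQuotient]
  field_simp

theorem gammaQuotientDeriv_zero {x : ℝ} (hx : -1 < x) : gammaQuotientDeriv 0 x = 1 := by
  have := (Real.Gamma_pos_of_pos (by linarith : 0 < x + 1)).ne'
  simp [gammaQuotientDeriv, gammaQuotient, this]

/-- Leibniz' rule applied to `∂G/∂z = G · (ψ(z) - ψ(x + z))`. -/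
theorem gammaQuotientDeriv_succ {x : ℝ} (hx : -1 < x) (m : ℕ) :
    gammaQuotientDeriv (m + 1) x = ∑ i ∈ range (m + 1), m.choose i * gammaQuotientDeriv i x *
      (iteratedDeriv (m - i) realDigamma 1 - iteratedDeriv (m - i) realDigamma (x + 1)) := by
  have hx1 : 0 < x + 1 := by linarith
  have hev : deriv (gammaQuotient x) =ᶠ[𝓝 1]
      fun z => gammaQuotient x z * (realDigamma z - realDigamma (x + z)) := by
    filter_upwards [lt_mem_nhds one_pos, lt_mem_nhds (show -x < 1 by linarith)] with z hz hz'
    exact deriv_gammaQuotient hz (by linarith)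
  have hψ : AnalyticAt ℝ (fun z => realDigamma (x + z)) 1 :=
    (analyticAt_realDigamma hx1).comp (analyticAt_const.add analyticAt_id)
  have hψ1 := analyticAt_realDigamma one_pos
  have hsub : AnalyticAt ℝ (fun z => realDigamma z - realDigamma (x + z)) 1 := hψ1.sub hψ
  rw [gammaQuotientDeriv, iteratedDeriv_succ', hev.iteratedDeriv_eq,
    iteratedDeriv_fun_mul (analyticAt_gammaQuotient one_pos hx1).contDiffAt hsub.contDiffAt]
  refine sum_congr rfl fun i _ => ?_
  rw [iteratedDeriv_fun_sub hψ1.contDiffAt hψ.contDiffAt, iteratedDeriv_comp_const_add]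
  rfl

theorem analyticAt_iteratedDeriv_realDigamma_add_one (n : ℕ) :
    AnalyticAt ℝ (fun x => iteratedDeriv n realDigamma (x + 1)) 0 := by
  have h : AnalyticAt ℝ (iteratedDeriv n realDigamma) 1 := by
    rw [iteratedDeriv_eq_iterate]
    exact (analyticAt_realDigamma one_pos).iterated_deriv n
  exact h.comp_of_eq (analyticAt_id.add analyticAt_const) (by simp)

/-- Analyticity in `x` follows by induction on `m` from `gammaQuotientDeriv_succ`; no joint
analyticity in `(x, z)` is needed. -/
theorem analyticAt_gammaQuotientDeriv (m : ℕ) : AnalyticAt ℝ (gammaQuotientDeriv m) 0 := by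
  have hev : ∀ᶠ x : ℝ in 𝓝 0, -1 < x := lt_mem_nhds (by norm_num)
  induction m using Nat.strong_induction_on with
  | _ m ih =>
    rcases m with _ | m
    · exact (analyticAt_const (v := (1 : ℝ))).congr
        (hev.mono fun x hx => (gammaQuotientDeriv_zero hx).symm)
    · refine AnalyticAt.congr (f := fun x => ∑ i ∈ range (m + 1), m.choose i *
        gammaQuotientDeriv i x * (iteratedDeriv (m - i) realDigamma 1 -
          iteratedDeriv (m - i) realDigamma (x + 1))) ?_
        (hev.mono fun x hx => (gammaQuotientDeriv_succ hx m).symm)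
      refine Finset.analyticAt_fun_sum _ fun i hi => ?_
      exact (analyticAt_const.mul (ih i (mem_range.mp hi))).mul
        (analyticAt_const.sub (analyticAt_iteratedDeriv_realDigamma_add_one _))

/-- The value `ζ(s)` at a natural number `s ≥ 2`, as a real series (with junk value for `s ≤ 1`). -/
noncomputable def zetaSum (s : ℕ) : ℝ := ∑' k : ℕ, 1 / ((k : ℝ) + 1) ^ s

theorem iteratedDeriv_realDigamma_one {n : ℕ} (hn : n ≠ 0) :
    iteratedDeriv n realDigamma 1 = (-1) ^ (n + 1) * n.factorial * zetaSum (n + 1) := by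
  have h := (hasSum_iteratedDeriv_realDigamma hn).tsum_eq
  have h2 : ∑' k : ℕ, (-1) ^ (n + 1) / ((k : ℝ) + 1) ^ (n + 1) =
      (-1) ^ (n + 1) * zetaSum (n + 1) := by
    rw [zetaSum, ← tsum_mul_left]
    exact tsum_congr fun k => by ring
  have hf : (n.factorial : ℝ) ≠ 0 := by positivity
  rw [h2, eq_div_iff hf] at h
  rw [← h]; ring

/-- The coefficient of `uⁿ vᵐ` in the expansion of `Γ(1 - u) Γ(1 - v) / Γ(1 - u - v)` at the origin:
the sign `(-1) ^ (m + n)` accounts for the substitution `x = -u`, `z = 1 - v`. -/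
noncomputable def taylorCoeff (m n : ℕ) : ℝ :=
  (-1) ^ (m + n) * iteratedDeriv n (gammaQuotientDeriv m) 0 / (m.factorial * n.factorial)

theorem iteratedDeriv_realDigamma_one_sub (p q : ℕ) :
    iteratedDeriv q (fun x => iteratedDeriv p realDigamma 1 - iteratedDeriv p realDigamma (x + 1)) 0
      = if q = 0 then 0 else
        (-1) ^ (p + q) * (p + q).factorial * zetaSum (p + q + 1) := by
  split_ifs with hq
  · subst hq; simp
  · rw [iteratedDeriv_fun_sub contDiffAt_const
      (analyticAt_iteratedDeriv_realDigamma_add_one p).contDiffAt, iteratedDeriv_const, if_neg hq,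
      iteratedDeriv_comp_add_const]
    simp only [zero_add, zero_sub]
    have : iteratedDeriv q (iteratedDeriv p realDigamma) = iteratedDeriv (p + q) realDigamma := by
      simp only [iteratedDeriv_eq_iterate]
      rw [add_comm, Function.iterate_add_apply]
    rw [this, iteratedDeriv_realDigamma_one (by omega)]
    ring

/-- The recurrence in `m` obtained by taking `n` derivatives in `x` of `gammaQuotientDeriv_succ`.
The term `r = n` is absent since `ψ⁽ᵖ⁾(1) - ψ⁽ᵖ⁾(x + 1)` vanishes at `x = 0`. -/
theorem taylorCoeff_succ (m n : ℕ) :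
    (m + 1) * taylorCoeff (m + 1) n = -∑ i ∈ range (m + 1), ∑ r ∈ range n,
      taylorCoeff i r * ((m - i + (n - r)).choose (n - r)) * zetaSum (m - i + (n - r) + 1) := by
  have hev : gammaQuotientDeriv (m + 1) =ᶠ[𝓝 0] fun x => ∑ i ∈ range (m + 1),
      m.choose i * gammaQuotientDeriv i x * (iteratedDeriv (m - i) realDigamma 1 -
        iteratedDeriv (m - i) realDigamma (x + 1)) := by
    filter_upwards [lt_mem_nhds (show (-1 : ℝ) < 0 by norm_num)] with x hx
    exact gammaQuotientDeriv_succ hx m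
  have han : ∀ i, AnalyticAt ℝ (fun x => (m.choose i : ℝ) * gammaQuotientDeriv i x) 0 :=
    fun i => analyticAt_const.mul (analyticAt_gammaQuotientDeriv i)
  have had : ∀ p, AnalyticAt ℝ (fun x => iteratedDeriv p realDigamma 1 -
      iteratedDeriv p realDigamma (x + 1)) 0 :=
    fun p => analyticAt_const.sub (analyticAt_iteratedDeriv_realDigamma_add_one p)
  have hmul : ∀ i, AnalyticAt ℝ (fun x => (m.choose i : ℝ) * gammaQuotientDeriv i x *
      (iteratedDeriv (m - i) realDigamma 1 - iteratedDeriv (m - i) realDigamma (x + 1))) 0 :=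
    fun i => (han i).mul (had (m - i))
  rw [taylorCoeff, hev.iteratedDeriv_eq, iteratedDeriv_fun_sum fun i _ => (hmul i).contDiffAt]
  rw [mul_sum, sum_div, mul_sum, ← sum_neg_distrib]
  refine sum_congr rfl fun i hi => ?_
  rw [iteratedDeriv_fun_mul (han i).contDiffAt (had _).contDiffAt, sum_range_succ,
    iteratedDeriv_realDigamma_one_sub, if_pos (by omega), mul_zero, add_zero, mul_sum, sum_div,
    mul_sum, ← sum_neg_distrib]
  refine sum_congr rfl fun r hr => ?_
  have hi' : i ≤ m := Nat.lt_succ_iff.mp (mem_range.mp hi)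
  have hr' : r < n := mem_range.mp hr
  obtain ⟨p, rfl⟩ := Nat.exists_eq_add_of_le hi'
  obtain ⟨q, rfl⟩ := Nat.exists_eq_add_of_le hr'.le
  have hq : q ≠ 0 := by omega
  rw [iteratedDeriv_realDigamma_one_sub, iteratedDeriv_const_mul_field]
  simp only [Nat.add_sub_cancel_left, if_neg hq, taylorCoeff]
  rw [← Nat.choose_symm_add, Nat.cast_add_choose, Nat.cast_add_choose, Nat.cast_add_choose,
    Nat.factorial_succ]
  have hp1 : ((i + p : ℕ) : ℝ) + 1 ≠ 0 := by positivity
  have hsign : (-1 : ℝ) ^ (p + q) * (-1) ^ (p + q) = 1 := by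
    rw [← mul_pow]; simp
  push_cast at hp1 ⊢
  field_simp
  have : (-1 : ℝ) ^ (i + p + 1 + (r + q)) * (-1) ^ (p + q) = - (-1) ^ (i + r) := by
    rw [show i + p + 1 + (r + q) = (i + r) + 1 + (p + q) by ring, pow_add, mul_assoc, hsign,
      pow_succ]
    ring
  linear_combination (iteratedDeriv r (gammaQuotientDeriv i) 0 * zetaSum (p + q + 1)) * this

/-! ### Elementary symmetric polynomials of reciprocals -/

/-- `recipEsymm k j` is the `j`-th elementary symmetric polynomial of `1, 1/2, …, 1/k`, given by its
recursion on the number of variables. -/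
noncomputable def recipEsymm : ℕ → ℕ → ℝ
  | 0, 0 => 1
  | 0, _ + 1 => 0
  | _ + 1, 0 => 1
  | k + 1, j + 1 => recipEsymm k (j + 1) + recipEsymm k j / (k + 1)

theorem recipEsymm_zero_right (k : ℕ) : recipEsymm k 0 = 1 := by
  cases k <;> rfl

theorem recipEsymm_succ_succ (k j : ℕ) :
    recipEsymm (k + 1) (j + 1) = recipEsymm k (j + 1) + recipEsymm k j / (k + 1) := rfl

theorem recipEsymm_nonneg (k j : ℕ) : 0 ≤ recipEsymm k j := by
  induction k generalizing j with
  | zero => cases j <;> simp [recipEsymm]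
  | succ k ih =>
    cases j with
    | zero => simp [recipEsymm]
    | succ j => exact add_nonneg (ih _) (div_nonneg (ih _) (by positivity))

theorem recipEsymm_one (k : ℕ) : recipEsymm k 1 = harmonic k := by
  induction k with
  | zero => simp [recipEsymm]
  | succ k ih =>
    rw [recipEsymm_succ_succ, ih, recipEsymm_zero_right, harmonic_succ]
    push_cast; ring

theorem genHarmonic_succ (s k : ℕ) :
    genHarmonic s (k + 1) = genHarmonic s k + 1 / ((k : ℚ) + 1) ^ s := by
  rw [genHarmonic, genHarmonic, sum_Icc_succ_top (by omega)]
  push_cast; rfl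

theorem recipEsymm_two (k : ℕ) :
    2 * recipEsymm k 2 = (harmonic k : ℝ) ^ 2 - (genHarmonic 2 k : ℝ) := by
  induction k with
  | zero => simp [recipEsymm, genHarmonic]
  | succ k ih =>
    rw [recipEsymm_succ_succ, mul_add, ih, recipEsymm_one, harmonic_succ, genHarmonic_succ]
    push_cast; field_simp; ring

/-- The product `∏_{i=1}^k (1 + x / i)`. -/
noncomputable def recipProd (k : ℕ) (x : ℝ) : ℝ := ∏ i ∈ range k, (1 + x / (i + 1))

theorem recipProd_succ (k : ℕ) (x : ℝ) :
    recipProd (k + 1) x = recipProd k x * (1 + x / (k + 1)) := prod_range_succ _ _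

theorem recipProd_pos {x : ℝ} (hx : -1 < x) (k : ℕ) : 0 < recipProd k x := by
  refine prod_pos fun i _ => ?_
  have hi : (0 : ℝ) ≤ i := Nat.cast_nonneg i
  rw [show 1 + x / ((i : ℝ) + 1) = (i + 1 + x) / (i + 1) by field_simp]
  have : 0 < (i : ℝ) + 1 + x := by linarith
  positivity

theorem hasSum_recipEsymm (k : ℕ) (x : ℝ) :
    HasSum (fun j => recipEsymm k j * x ^ j) (recipProd k x) := by
  induction k with
  | zero =>
    refine (hasSum_ite_eq 0 (1 : ℝ)).congr_fun fun j => ?_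
    cases j <;> simp [recipEsymm]
  | succ k ih =>
    rw [recipProd_succ]
    refine (hasSum_nat_add_iff' 1).mp ?_
    have h1 := (hasSum_nat_add_iff' 1).mpr ih
    have h2 := ih.mul_left (x / (k + 1))
    simp only [range_one, sum_singleton, recipEsymm_zero_right] at h1 ⊢
    have h3 := h1.add h2
    rw [show recipProd k x * (1 + x / (k + 1)) - 1 * x ^ 0 =
      recipProd k x - 1 * x ^ 0 + x / (k + 1) * recipProd k x by ring]
    refine h3.congr_fun fun j => ?_
    rw [recipEsymm_succ_succ, pow_succ]
    ring

theorem summable_sub_succ_of_antitone {v : ℕ → ℝ} (hv : Antitone v) (h0 : ∀ k, 0 ≤ v k) :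
    Summable fun k => v k - v (k + 1) := by
  refine summable_of_sum_range_le (c := v 0) (fun k => sub_nonneg.mpr (hv k.le_succ)) fun n => ?_
  rw [sum_range_sub']
  linarith [h0 n]

/-- The terms are, up to the factor `x`, the decrements of the positive decreasing sequence
`recipProd k (-x)`. -/
theorem summable_recipProd_neg_div {x : ℝ} (hx : 0 < x) (hx1 : x < 1) :
    Summable fun k : ℕ => recipProd k (-x) / (k + 1) := by
  have hstep : ∀ k : ℕ, recipProd k (-x) - recipProd (k + 1) (-x) =
      x * (recipProd k (-x) / (k + 1)) := fun k => by
    rw [recipProd_succ]; ring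
  have hpos := recipProd_pos (x := -x) (by linarith)
  have h := summable_sub_succ_of_antitone (v := fun k => recipProd k (-x))
    (antitone_nat_of_succ_le fun k => by
      have := hstep k
      have : 0 ≤ x * (recipProd k (-x) / (k + 1)) :=
        mul_nonneg hx.le (div_nonneg (hpos k).le (by positivity))
      linarith) fun k => (hpos k).le
  simp only [hstep] at h
  exact (summable_mul_left_iff hx.ne').mp h

/-- The terms are comparable to the decrements of the positive decreasing sequence
`recipProd k x / (k + 1)`. -/
theorem summable_recipProd_div_sq {x : ℝ} (hx : 0 ≤ x) (hx1 : x < 1) :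
    Summable fun k : ℕ => recipProd k x / ((k : ℝ) + 1) ^ 2 := by
  have hstep : ∀ k : ℕ, recipProd k x / ((k : ℝ) + 1) - recipProd (k + 1) x / ((k + 1 : ℕ) + 1) =
      (1 - x) * (recipProd k x / ((k + 1) * (k + 2))) := fun k => by
    rw [recipProd_succ]; push_cast; field_simp; ring
  have hpos := recipProd_pos (x := x) (by linarith)
  have hnn : ∀ k : ℕ, 0 ≤ recipProd k x / (((k : ℝ) + 1) * (k + 2)) := fun k =>
    div_nonneg (hpos k).le (by positivity)
  have h := summable_sub_succ_of_antitone (v := fun k : ℕ => recipProd k x / ((k : ℝ) + 1))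
    (antitone_nat_of_succ_le fun k => by
      have := hstep k
      have := mul_nonneg (sub_nonneg.mpr hx1.le) (hnn k)
      linarith) fun k => div_nonneg (hpos k).le (by positivity)
  simp only [hstep] at h
  have h' := ((summable_mul_left_iff (sub_pos.mpr hx1).ne').mp h).mul_left 2
  refine Summable.of_nonneg_of_le (fun k => div_nonneg (hpos k).le (by positivity)) (fun k => ?_) h'
  have hk : (0 : ℝ) ≤ k := Nat.cast_nonneg k
  rw [mul_div_assoc', div_le_div_iff₀ (by positivity) (by positivity)]
  have := hpos k
  have h2 : ((k : ℝ) + 1) * (k + 2) ≤ 2 * (k + 1) ^ 2 := by nlinarith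
  nlinarith

/-- Expansion in powers of `x` of `∑ₖ x ∏_{i ≤ k} (1 - x / i) / (k + 1) ^ (m + 1)`. -/
theorem hasSum_iteratedDeriv_tsum_recipProd {m : ℕ} (hm : 1 ≤ m) :
    AnalyticAt ℝ (fun x => ∑' k : ℕ, x * recipProd k (-x) / ((k : ℝ) + 1) ^ (m + 1)) 0 ∧
    ∀ n, HasSum (fun k : ℕ => (-1) ^ n * recipEsymm k n / ((k : ℝ) + 1) ^ (m + 1))
      (iteratedDeriv (n + 1)
        (fun x => ∑' k : ℕ, x * recipProd k (-x) / ((k : ℝ) + 1) ^ (m + 1)) 0 /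
          (n + 1).factorial) := by
  let a : ℕ → ℕ → ℝ := fun k j =>
    match j with
    | 0 => 0
    | j + 1 => (-1) ^ j * recipEsymm k j / ((k : ℝ) + 1) ^ (m + 1)
  let b : ℕ → ℕ → ℝ := fun k j => |a k j| * (1 / 2) ^ j
  have hb : ∀ k, HasSum (b k) (1 / 2 * recipProd k (1 / 2) / ((k : ℝ) + 1) ^ (m + 1)) := by
    intro k
    refine (hasSum_nat_add_iff' 1).mp ?_
    have h := (hasSum_recipEsymm k (1 / 2)).mul_left (1 / 2 / ((k : ℝ) + 1) ^ (m + 1))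
    rw [show 1 / 2 * recipProd k (1 / 2) / ((k : ℝ) + 1) ^ (m + 1) - ∑ i ∈ range 1, b k i =
      1 / 2 / ((k : ℝ) + 1) ^ (m + 1) * recipProd k (1 / 2) by simp [b, a]; ring]
    refine h.congr_fun fun j => ?_
    have hk : 0 < ((k : ℝ) + 1) ^ (m + 1) := by positivity
    simp only [b, a, abs_div, abs_mul, abs_pow, abs_neg, abs_one, one_pow, one_mul,
      abs_of_nonneg (recipEsymm_nonneg k j), abs_of_pos (by positivity : 0 < (k : ℝ) + 1), pow_succ]
    ring
  have hbs : Summable fun k : ℕ => 1 / 2 * recipProd k (1 / 2) / ((k : ℝ) + 1) ^ (m + 1) := by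
    refine Summable.of_nonneg_of_le (fun k => ?_) (fun k => ?_)
      (summable_recipProd_div_sq (x := 1 / 2) (by norm_num) (by norm_num))
    · have := recipProd_pos (x := 1 / 2) (by norm_num) k
      positivity
    · have := recipProd_pos (x := 1 / 2) (by norm_num) k
      have hk : (1 : ℝ) ≤ k + 1 := by linarith [(Nat.cast_nonneg k : (0 : ℝ) ≤ k)]
      have : ((k : ℝ) + 1) ^ 2 ≤ ((k : ℝ) + 1) ^ (m + 1) := pow_le_pow_right₀ hk (by omega)
      gcongr
      linarith
  -- Taking absolute values turns `∏ (1 - x / i)` at `x = 1/2` into `∏ (1 + 1 / (2 i))`.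
  have hs : Summable fun p : ℕ × ℕ => |a p.1 p.2| * (1 / 2 : ℝ) ^ p.2 := by
    refine (summable_prod_of_nonneg fun p => by positivity).mpr ⟨fun k => (hb k).summable, ?_⟩
    exact hbs.congr fun k => (hb k).tsum_eq.symm
  have hF : ∀ (k : ℕ) (y : ℝ), |y| < 1 / 2 → HasSum (fun j => a k j * y ^ j)
      (y * recipProd k (-y) / ((k : ℝ) + 1) ^ (m + 1)) := by
    intro k y _
    refine (hasSum_nat_add_iff' 1).mp ?_
    have h := (hasSum_recipEsymm k (-y)).mul_left (y / ((k : ℝ) + 1) ^ (m + 1))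
    rw [show y * recipProd k (-y) / ((k : ℝ) + 1) ^ (m + 1) - ∑ i ∈ range 1, a k i * y ^ i =
      y / ((k : ℝ) + 1) ^ (m + 1) * recipProd k (-y) by simp [a]; ring]
    refine h.congr_fun fun j => ?_
    simp only [a]
    rw [neg_pow y, pow_succ y]
    ring
  have hf : ∀ y : ℝ, |y| < 1 / 2 →
      HasSum (fun k : ℕ => y * recipProd k (-y) / ((k : ℝ) + 1) ^ (m + 1))
        (∑' k : ℕ, y * recipProd k (-y) / ((k : ℝ) + 1) ^ (m + 1)) := by
    intro y hy
    have h2 : Summable fun p : ℕ × ℕ => a p.1 p.2 * y ^ p.2 := by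
      refine Summable.of_norm_bounded hs fun p => ?_
      rw [Real.norm_eq_abs, abs_mul, abs_pow]
      gcongr
    exact (h2.prod.congr fun k => (hF k y hy).tsum_eq).hasSum
  have key := analyticAt_and_hasSum_iteratedDeriv (by norm_num) hs hF hf
  exact ⟨key.1, fun n => key.2 (n + 1)⟩

/-! ### The Gamma quotient as a series -/

theorem ringChoose_eq_recipProd (x : ℝ) (n : ℕ) :
    Ring.choose (1 - x + n - 1) n = recipProd n (-x) := by
  have h : ∀ n : ℕ, (ascPochhammer ℝ n).eval (1 - x) = n.factorial * recipProd n (-x) := by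
    intro n
    induction n with
    | zero => simp [recipProd]
    | succ n ih =>
      rw [ascPochhammer_succ_eval, ih, recipProd_succ, Nat.factorial_succ]
      push_cast; field_simp; ring
  have h2 := Ring.factorial_nsmul_multichoose_eq_ascPochhammer (1 - x) n
  rw [Polynomial.ascPochhammer_smeval_eq_eval, h, nsmul_eq_mul] at h2
  have h3 : Ring.choose (1 - x + n - 1) n = Ring.multichoose (1 - x) n := by
    rw [Ring.choose]; congr 1; ring
  rw [h3]
  exact mul_left_cancel₀ (by positivity) h2

/-- The binomial series of `(1 - t) ^ (x - 1)`. -/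
theorem hasSum_one_sub_rpow (x : ℝ) {t : ℝ} (h0 : 0 ≤ t) (h1 : t < 1) :
    HasSum (fun k : ℕ => recipProd k (-x) * t ^ k) ((1 - t) ^ (x - 1)) := by
  have h := (Real.one_div_one_sub_rpow_hasFPowerSeriesOnBall_zero (1 - x)).hasSum (y := t) (by
    rw [← ENNReal.ofReal_one, Metric.eball_ofReal]
    simpa [abs_of_nonneg h0] using h1)
  rw [zero_add, one_div, ← Real.rpow_neg (by linarith), neg_sub] at h
  refine h.congr_fun fun k => ?_
  rw [← ringChoose_eq_recipProd]
  simp [mul_comm]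

theorem integral_Ioo_rpow_sub_one {s : ℝ} (hs : 0 < s) :
    IntegrableOn (fun t : ℝ => t ^ (s - 1)) (Set.Ioo 0 1) ∧
      ∫ t in Set.Ioo (0 : ℝ) 1, t ^ (s - 1) = 1 / s := by
  have hi := intervalIntegral.intervalIntegrable_rpow' (a := 0) (b := 1) (r := s - 1) (by linarith)
  constructor
  · exact ((intervalIntegrable_iff_integrableOn_Ioo_of_le zero_le_one).mp hi)
  · rw [← integral_Ioc_eq_integral_Ioo, ← intervalIntegral.integral_of_le zero_le_one,
      integral_rpow (Or.inl (by linarith))]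
    simp [Real.zero_rpow hs.ne']

theorem beta_eq_integral_Ioo {u v : ℝ} (hu : 0 < u) (hv : 0 < v) :
    ProbabilityTheory.beta u v =
      ∫ t in Set.Ioo (0 : ℝ) 1, t ^ (u - 1) * (1 - t) ^ (v - 1) := by
  rw [ProbabilityTheory.beta_eq_betaIntegralReal u v hu hv, Complex.betaIntegral,
    intervalIntegral.integral_of_le zero_le_one, ← integral_Ioc_eq_integral_Ioo,
    ← RCLike.re_to_complex, ← integral_re]
  · refine setIntegral_congr_fun measurableSet_Ioc fun t ⟨ht1, ht2⟩ => ?_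
    norm_cast
    rw [← Complex.ofReal_cpow, ← Complex.ofReal_cpow, RCLike.re_to_complex,
      Complex.re_mul_ofReal, Complex.ofReal_re]
    all_goals linarith
  · have := Complex.betaIntegral_convergent (u := u) (v := v) (by simpa) (by simpa)
    rwa [intervalIntegrable_iff_integrableOn_Ioc_of_le zero_le_one, IntegrableOn] at this

/-- The partial fraction expansion of `Γ(x + 1) Γ(z) / Γ(x + z) = x B(z, x)` in `z`, by integrating
the binomial series in the Beta integral term by term. -/
theorem hasSum_gammaQuotient {x z : ℝ} (hx : 0 < x) (hx1 : x < 1) (hz : 0 < z) :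
    HasSum (fun k : ℕ => x * recipProd k (-x) / (k + z)) (gammaQuotient x z) := by
  have hpos := recipProd_pos (x := -x) (by linarith)
  have hk : ∀ k : ℕ, 0 < (k : ℝ) + z := fun k => by positivity
  let F : ℕ → ℝ → ℝ := fun k t => recipProd k (-x) * t ^ ((k : ℝ) + z - 1)
  have hFi : ∀ k, IntegrableOn (F k) (Set.Ioo 0 1) := fun k =>
    (integral_Ioo_rpow_sub_one (hk k)).1.const_mul _
  have hFv : ∀ k, ∫ t in Set.Ioo (0 : ℝ) 1, F k t = recipProd k (-x) / (k + z) := fun k => by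
    simp only [F]
    rw [integral_const_mul, (integral_Ioo_rpow_sub_one (hk k)).2, mul_one_div]
  have hFn : ∀ k, ∫ t in Set.Ioo (0 : ℝ) 1, ‖F k t‖ = recipProd k (-x) / (k + z) := fun k => by
    rw [← hFv k]
    refine setIntegral_congr_fun measurableSet_Ioo fun t ht => ?_
    exact Real.norm_of_nonneg (mul_nonneg (hpos k).le (Real.rpow_nonneg ht.1.le _))
  have hsum : Summable fun k : ℕ => recipProd k (-x) / ((k : ℝ) + z) := by
    refine Summable.of_nonneg_of_le (fun k => div_nonneg (hpos k).le (hk k).le) (fun k => ?_)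
      ((summable_recipProd_neg_div hx hx1).mul_left (1 + 1 / z))
    have := hpos k
    rw [mul_div_assoc', div_le_div_iff₀ (hk k) (by positivity)]
    have h2 : (k : ℝ) + 1 ≤ (1 + 1 / z) * (k + z) := by
      rw [show (1 + 1 / z) * ((k : ℝ) + z) = k + 1 + (z + k / z) by field_simp; ring]
      have : 0 ≤ z + k / z := by positivity
      linarith
    nlinarith
  have h := hasSum_integral_of_summable_integral_norm hFi (by simpa only [hFn] using hsum)
  simp only [hFv] at h
  have hint : ∫ t in Set.Ioo (0 : ℝ) 1, ∑' k, F k t = ProbabilityTheory.beta z x := by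
    rw [beta_eq_integral_Ioo hz hx]
    refine setIntegral_congr_fun measurableSet_Ioo fun t ht => ?_
    refine (((hasSum_one_sub_rpow x ht.1.le ht.2).mul_left (t ^ (z - 1))).congr_fun
      fun k => ?_).tsum_eq
    simp only [F]
    rw [add_sub_assoc, Real.rpow_add ht.1, Real.rpow_natCast]
    ring
  rw [hint] at h
  have hG : gammaQuotient x z = x * ProbabilityTheory.beta z x := by
    rw [gammaQuotient, ProbabilityTheory.beta, Real.Gamma_add_one hx.ne', add_comm z x]
    ring
  rw [hG]
  exact (h.mul_left x).congr_fun fun k => by ring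

/-- The series of `hasSum_gammaQuotient`, differentiated `m` times in `z` at `z = 1`. -/
theorem gammaQuotientDeriv_eq_tsum {x : ℝ} (hx : 0 < x) (hx1 : x < 1) (m : ℕ) :
    gammaQuotientDeriv m x = (-1) ^ m * m.factorial *
      ∑' k : ℕ, x * recipProd k (-x) / ((k : ℝ) + 1) ^ (m + 1) := by
  have hpos := recipProd_pos (x := -x) (by linarith)
  let a : ℕ → ℕ → ℝ := fun k j => x * recipProd k (-x) * ((-1) ^ j / ((k : ℝ) + 1) ^ (j + 1))
  have hb := (summable_recipProd_neg_div hx hx1).mul_left x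
  have key := analyticAt_and_hasSum_iteratedDeriv (a := a) (r := 1 / 2) (by norm_num)
    (F := fun k y => x * recipProd k (-x) * (1 / (k + 1 + y)))
    (f := fun y => gammaQuotient x (1 + y))
    (summable_geometric_half_mul hb
      (fun k => mul_nonneg hx.le (div_nonneg (hpos k).le (by positivity))) fun k j => ?_)
    (fun k y hy => ?_) (fun y hy => ?_)
  · have h := (key.2 m).tsum_eq
    rw [iteratedDeriv_comp_const_add] at h
    simp only [add_zero] at h
    rw [eq_div_iff (by positivity)] at h
    rw [gammaQuotientDeriv, ← h, mul_right_comm, ← tsum_mul_left]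
    congr 1
    exact tsum_congr fun k => by simp only [a]; ring
  · simp only [a]
    have hk : (1 : ℝ) ≤ k + 1 := by linarith [(Nat.cast_nonneg k : (0 : ℝ) ≤ k)]
    rw [abs_mul, abs_of_pos (mul_pos hx (hpos k)), abs_div, abs_pow, abs_neg, abs_one, one_pow,
      abs_of_pos (by positivity), mul_div_assoc', mul_one, mul_div_assoc']
    have := mul_pos hx (hpos k)
    gcongr
    exact le_self_pow₀ hk (by omega)
  · refine ((hasSum_geometric_inv_add k hy).mul_left (x * recipProd k (-x))).congr_fun fun j => ?_
    simp only [a]; ring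
  · refine (hasSum_gammaQuotient hx hx1 (z := 1 + y) ?_).congr_fun fun k => ?_
    · linarith [(abs_lt.mp hy).1]
    · rw [add_assoc, mul_one_div]

/-- The Taylor coefficients as the sums `∑ₖ eₙ(1, 1/2, …, 1/k) / (k + 1) ^ (m + 1)`. Both sides of
`gammaQuotientDeriv_eq_tsum` are analytic at `x = 0`, so that their agreement for small positive `x`
extends to a neighbourhood of `0`. -/
theorem hasSum_taylorCoeff {m : ℕ} (hm : 1 ≤ m) (n : ℕ) :
    HasSum (fun k : ℕ => recipEsymm k n / ((k : ℝ) + 1) ^ (m + 1)) (-taylorCoeff m (n + 1)) := by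
  obtain ⟨han, hsum⟩ := hasSum_iteratedDeriv_tsum_recipProd hm
  have hev : gammaQuotientDeriv m =ᶠ[𝓝 0] fun x => ((-1) ^ m * m.factorial : ℝ) *
      ∑' k : ℕ, x * recipProd k (-x) / ((k : ℝ) + 1) ^ (m + 1) := by
    refine ((analyticAt_gammaQuotientDeriv m).frequently_eq_iff_eventually_eq
      (analyticAt_const.mul han)).mp ?_
    have hpos : ∀ᶠ x : ℝ in 𝓝[>] 0, x ∈ Set.Ioo (0 : ℝ) 1 := Ioo_mem_nhdsGT one_pos
    refine (hpos.mono fun x hx => gammaQuotientDeriv_eq_tsum hx.1 hx.2 m).frequently.filter_mono ?_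
    exact nhdsWithin_mono _ fun x hx => ne_of_gt hx
  have h := (hsum n).mul_left ((-1) ^ n)
  rw [taylorCoeff, hev.iteratedDeriv_eq, iteratedDeriv_const_mul_field]
  have hs : ∀ p : ℕ, (-1 : ℝ) ^ p * (-1) ^ p = 1 := fun p => by rw [← mul_pow]; simp
  have hval : (-1) ^ n * (iteratedDeriv (n + 1) (fun x : ℝ =>
      ∑' k : ℕ, x * recipProd k (-x) / ((k : ℝ) + 1) ^ (m + 1)) 0 / (n + 1).factorial) =
      -((-1) ^ (m + (n + 1)) * ((-1) ^ m * m.factorial * iteratedDeriv (n + 1) (fun x : ℝ =>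
        ∑' k : ℕ, x * recipProd k (-x) / ((k : ℝ) + 1) ^ (m + 1)) 0) /
          (m.factorial * (n + 1).factorial)) := by
    rw [pow_add, pow_succ (-1 : ℝ) n]
    field_simp
    linear_combination (-iteratedDeriv (n + 1) (fun x : ℝ =>
      ∑' k : ℕ, x * recipProd k (-x) / ((k : ℝ) + 1) ^ (m + 1)) 0) * hs m
  rw [← hval]
  refine h.congr_fun fun k => ?_
  rw [mul_div_assoc', ← mul_assoc, hs, one_mul]

/-! ### Solving the recurrence for the Taylor coefficients -/

theorem taylorCoeff_zero_left (n : ℕ) : taylorCoeff 0 n = if n = 0 then 1 else 0 := by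
  have hev : gammaQuotientDeriv 0 =ᶠ[𝓝 0] fun _ => 1 := by
    filter_upwards [lt_mem_nhds (show (-1 : ℝ) < 0 by norm_num)] with x hx
    exact gammaQuotientDeriv_zero hx
  rw [taylorCoeff, hev.iteratedDeriv_eq, iteratedDeriv_const]
  split_ifs with h <;> simp [h]

theorem taylorCoeff_succ_zero (m : ℕ) : taylorCoeff (m + 1) 0 = 0 := by
  have h := taylorCoeff_succ m 0
  simp only [range_zero, sum_empty, sum_const_zero, neg_zero] at h
  exact (mul_eq_zero.mp h).resolve_left (by positivity)

theorem taylorCoeff_succ_one (m : ℕ) : taylorCoeff (m + 1) 1 = -zetaSum (m + 2) := by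
  have h := taylorCoeff_succ m 1
  rw [sum_range_succ'] at h
  simp only [range_one, sum_singleton, taylorCoeff_succ_zero, taylorCoeff_zero_left, if_true,
    zero_mul, sum_const_zero, zero_add, Nat.sub_zero, one_mul, Nat.choose_one_right] at h
  push_cast at h
  exact mul_left_cancel₀ (by positivity : (m : ℝ) + 1 ≠ 0) (by linarith)

/-- The summand is symmetric under `i ↦ m - 1 - i` up to the weight, and the weights `m - i` and
`i + 1` of paired terms add up to `m + 1`. -/
theorem two_mul_sum_mul_zetaSum (m : ℕ) :
    2 * ∑ i ∈ range m, (m - i) * (zetaSum (i + 2) * zetaSum (m - i + 1)) =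
      (m + 1) * ∑ i ∈ range m, zetaSum (i + 2) * zetaSum (m - i + 1) := by
  have h : ∑ i ∈ range m, ((m : ℝ) - i) * (zetaSum (i + 2) * zetaSum (m - i + 1)) =
      ∑ i ∈ range m, ((i : ℝ) + 1) * (zetaSum (i + 2) * zetaSum (m - i + 1)) := by
    rw [← sum_range_reflect]
    refine sum_congr rfl fun i hi => ?_
    have hi' : i < m := mem_range.mp hi
    obtain ⟨p, rfl⟩ := Nat.exists_eq_add_of_lt hi'
    rw [show i + p + 1 - 1 - i = p by omega, show i + p + 1 - p + 1 = i + 2 by omega,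
      show i + p + 1 - i + 1 = p + 2 by omega]
    push_cast; ring
  rw [two_mul]
  nth_rewrite 2 [h]
  rw [← sum_add_distrib, mul_sum]
  exact sum_congr rfl fun i _ => by ring

/-- Euler's evaluation of the linear sums `2 ∑ₖ Hₖ / (k + 1) ^ (m + 2)`. -/
theorem two_mul_neg_taylorCoeff_two (m : ℕ) :
    2 * -taylorCoeff (m + 1) 2 =
      (m + 2) * zetaSum (m + 3) - ∑ i ∈ range m, zetaSum (i + 2) * zetaSum (m - i + 1) := by
  have h := taylorCoeff_succ m 2
  rw [sum_range_succ'] at h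
  simp only [sum_range_succ, range_zero, sum_empty, zero_add, taylorCoeff_zero_left,
    taylorCoeff_succ_zero, taylorCoeff_succ_one, if_true, if_false, one_ne_zero, Nat.sub_zero,
    zero_mul, one_mul, add_zero, Nat.choose_one_right, Nat.add_one_sub_one] at h
  have e : ∑ i ∈ range m, -zetaSum (i + 2) * ((m - (i + 1) + 1 : ℕ) : ℝ) *
      zetaSum (m - (i + 1) + 1 + 1) =
      -∑ i ∈ range m, (m - i) * (zetaSum (i + 2) * zetaSum (m - i + 1)) := by
    rw [← sum_neg_distrib]
    refine sum_congr rfl fun i hi => ?_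
    have hi' : i < m := mem_range.mp hi
    rw [show m - (i + 1) + 1 = m - i by omega, Nat.cast_sub hi'.le]
    ring
  rw [e, Nat.cast_choose_two] at h
  push_cast at h
  have h2 := two_mul_sum_mul_zetaSum m
  refine mul_left_cancel₀ (by positivity : (m : ℝ) + 1 ≠ 0) ?_
  linear_combination (-2) * h - h2

theorem two_mul_neg_taylorCoeff_three (m : ℕ) :
    2 * -taylorCoeff (m + 1) 3 =
      (m + 2) * (m + 3) / 3 * zetaSum (m + 4)
        - ∑ i ∈ range m, (i + 2) * zetaSum (i + 3) * zetaSum (m - i + 1)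
        + 1 / (m + 1) * ∑ i ∈ range m, (m - i) * zetaSum (m - i + 1) *
            ∑ j ∈ range i, zetaSum (j + 2) * zetaSum (i - j + 1) := by
  have h := taylorCoeff_succ m 3
  rw [sum_range_succ'] at h
  simp only [sum_range_succ _ 2, sum_range_succ _ 1, sum_range_succ _ 0, range_zero, sum_empty,
    zero_add, taylorCoeff_zero_left,
    taylorCoeff_succ_zero, taylorCoeff_succ_one, if_true, if_false, one_ne_zero, Nat.sub_zero,
    zero_mul, one_mul, add_zero, Nat.choose_one_right, Nat.add_one_sub_one, Nat.reduceSub,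
    two_ne_zero, sum_add_distrib] at h
  have e1 : ∑ i ∈ range m, -zetaSum (i + 2) * ((m - (i + 1) + 2).choose 2 : ℝ) *
      zetaSum (m - (i + 1) + 2 + 1) =
      -∑ i ∈ range m, (i + 1) * (i + 2) / 2 * (zetaSum (i + 3) * zetaSum (m - i + 1)) := by
    rw [← sum_neg_distrib, ← sum_range_reflect]
    refine sum_congr rfl fun i hi => ?_
    have hi' : i < m := mem_range.mp hi
    obtain ⟨p, rfl⟩ := Nat.exists_eq_add_of_lt hi'
    rw [show i + p + 1 - 1 - i = p by omega, show i + p + 1 - (p + 1) + 2 = i + 2 by omega,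
      show i + p + 1 - i + 1 = p + 2 by omega, Nat.cast_choose_two]
    push_cast; ring
  have e2 : ∑ i ∈ range m, taylorCoeff (i + 1) 2 * ((m - (i + 1) + 1 : ℕ) : ℝ) *
      zetaSum (m - (i + 1) + 1 + 1) =
      -∑ i ∈ range m, (m - i) * (i + 2) / 2 * (zetaSum (i + 3) * zetaSum (m - i + 1))
      + 1 / 2 * ∑ i ∈ range m, (m - i) * zetaSum (m - i + 1) *
            ∑ j ∈ range i, zetaSum (j + 2) * zetaSum (i - j + 1) := by
    rw [← sum_neg_distrib, mul_sum, ← sum_add_distrib]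
    refine sum_congr rfl fun i hi => ?_
    have hi' : i < m := mem_range.mp hi
    rw [show m - (i + 1) + 1 = m - i by omega, Nat.cast_sub hi'.le]
    linear_combination (-1 / 2 * ((m : ℝ) - i) * zetaSum (m - i + 1)) *
      two_mul_neg_taylorCoeff_two i
  -- The weights `i + 1` and `m - i` of the two double sums add up to `m + 1`, which cancels the
  -- factor `m + 1` on the left of the recurrence.
  have e3 : ∑ i ∈ range m, ((i : ℝ) + 1) * (i + 2) / 2 * (zetaSum (i + 3) * zetaSum (m - i + 1)) +
      ∑ i ∈ range m, ((m : ℝ) - i) * (i + 2) / 2 * (zetaSum (i + 3) * zetaSum (m - i + 1)) =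
      (m + 1) / 2 * ∑ i ∈ range m, ((i : ℝ) + 2) * zetaSum (i + 3) * zetaSum (m - i + 1) := by
    rw [← sum_add_distrib, mul_sum]
    exact sum_congr rfl fun i _ => by ring
  have e4 : ((m + 3).choose 3 : ℝ) = (m + 1) * (m + 2) * (m + 3) / 6 := by
    rw [← Nat.choose_symm_add, Nat.cast_add_choose, Nat.factorial_succ, Nat.factorial_succ, Nat.factorial_succ]
    simp only [Nat.factorial]
    push_cast; field_simp; ring
  rw [e1, e2, e4] at h
  have hm : (m : ℝ) + 1 ≠ 0 := by positivity
  refine mul_left_cancel₀ hm ?_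
  field_simp
  linear_combination (-6) * h - 6 * e3

theorem riemannZeta_eq_zetaSum {s : ℕ} (hs : 1 < s) : riemannZeta s = zetaSum s := by
  have h := zeta_eq_tsum_one_div_nat_add_one_cpow (s := s) (by simpa using hs)
  rw [h, zetaSum, Complex.ofReal_tsum]
  refine tsum_congr fun k => ?_
  rw [Complex.cpow_natCast]
  push_cast; rfl

/-! ### The harmonic sums -/

theorem F₃_eq_taylorCoeff (m : ℕ) :
    (-1) ^ m / (3 * (m.factorial : ℝ)) * F₃ 0 m = 2 * -taylorCoeff m 3 := by
  have h : F₃ 0 m = iteratedDeriv 3 (gammaQuotientDeriv m) 0 := by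
    rw [F₃, Nat.cast_zero]; rfl
  rw [taylorCoeff, h, pow_add]
  simp only [Nat.factorial]
  push_cast
  field_simp
  ring

theorem sum_Icc_one_eq_sum_range {M : Type*} [AddCommMonoid M] (f : ℕ → M) (m : ℕ) :
    ∑ j ∈ Icc 1 m, f j = ∑ i ∈ range m, f (i + 1) := by
  rw [range_eq_Ico, sum_Ico_add' f 0 m 1]
  rfl

theorem hasSum_harmonic_sq_sub {m : ℕ} (hm : 1 ≤ m) :
    HasSum (fun k : ℕ => ((harmonic k : ℝ) ^ 2 - (genHarmonic 2 k : ℝ)) / ((k : ℝ) + 1) ^ (m + 1))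
      (2 * -taylorCoeff m 3) :=
  ((hasSum_taylorCoeff hm 2).mul_left 2).congr_fun fun k => by
    rw [← recipEsymm_two, mul_div_assoc]

/-- Since `e₂(1, …, 1/(k+1)) = e₂(1, …, 1/k) + Hₖ / (k + 1)`, the shifted series differs from the
unshifted one by the linear Euler sum. -/
theorem hasSum_harmonic_succ_sq_sub {m : ℕ} (hm : 1 ≤ m) :
    HasSum (fun k : ℕ => ((harmonic (k + 1) : ℝ) ^ 2 - (genHarmonic 2 (k + 1) : ℝ)) /
        ((k : ℝ) + 1) ^ (m + 1))
      (2 * -taylorCoeff m 3 + 2 * -taylorCoeff (m + 1) 2) :=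
  (((hasSum_taylorCoeff hm 2).mul_left 2).add
    ((hasSum_taylorCoeff (Nat.le_add_left 1 m) 1).mul_left 2)).congr_fun fun k => by
    rw [← recipEsymm_two, recipEsymm_succ_succ]
    field_simp
    ring

theorem corollary3p4 (m : ℕ) (hm : 1 ≤ m) :
    (HasSum
        (fun k : ℕ => ((harmonic k : ℂ) ^ 2 - (genHarmonic 2 k : ℂ)) / ((k : ℂ) + 1) ^ (m + 1))
        ((-1) ^ m / (3 * (m.factorial : ℂ)) * (F₃ 0 m : ℂ)) ∧
      (-1) ^ m / (3 * (m.factorial : ℂ)) * (F₃ 0 m : ℂ) =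
        ((m : ℂ) + 1) * ((m : ℂ) + 2) / 3 * riemannZeta ((m : ℂ) + 3)
        - ∑ j ∈ Finset.Icc 1 (m - 1),
            ((j : ℂ) + 1) * riemannZeta ((j : ℂ) + 2) * riemannZeta ((m : ℂ) + 1 - (j : ℂ))
        + 1 / (m : ℂ) * ∑ l ∈ Finset.Icc 1 (m - 1),
            ((m : ℂ) - (l : ℂ)) * riemannZeta ((m : ℂ) - (l : ℂ) + 1) *
              ∑ j ∈ Finset.Icc 1 (l - 1),
                riemannZeta ((j : ℂ) + 1) * riemannZeta ((l : ℂ) - (j : ℂ) + 1)) ∧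
    -- the series over `k ≥ 1`, written with `k + 1`, `k ≥ 0`, in place of `k`
    (HasSum
        (fun k : ℕ => ((harmonic (k + 1) : ℂ) ^ 2 - (genHarmonic 2 (k + 1) : ℂ)) /
          ((k + 1 : ℕ) : ℂ) ^ (m + 1))
        ((-1) ^ m / (3 * (m.factorial : ℂ)) * (F₃ 0 m : ℂ)
          + ((m : ℂ) + 2) * riemannZeta ((m : ℂ) + 3)
          - ∑ j ∈ Finset.Icc 1 m,
              riemannZeta ((j : ℂ) + 1) * riemannZeta ((m : ℂ) + 2 - (j : ℂ))) ∧
      (-1) ^ m / (3 * (m.factorial : ℂ)) * (F₃ 0 m : ℂ)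
          + ((m : ℂ) + 2) * riemannZeta ((m : ℂ) + 3)
          - ∑ j ∈ Finset.Icc 1 m,
              riemannZeta ((j : ℂ) + 1) * riemannZeta ((m : ℂ) + 2 - (j : ℂ)) =
        ((m : ℂ) + 2) * ((m : ℂ) + 4) / 3 * riemannZeta ((m : ℂ) + 3)
        - riemannZeta 2 * riemannZeta ((m : ℂ) + 1)
        - 2 * ∑ j ∈ Finset.Icc 2 m,
            riemannZeta ((j : ℂ) + 1) * riemannZeta ((m : ℂ) + 2 - (j : ℂ))
        - ∑ j ∈ Finset.Icc 1 (m - 1),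
            (j : ℂ) * riemannZeta ((j : ℂ) + 2) * riemannZeta ((m : ℂ) + 1 - (j : ℂ))
        + 1 / (m : ℂ) * ∑ l ∈ Finset.Icc 1 (m - 1),
            ((m : ℂ) - (l : ℂ)) * riemannZeta ((m : ℂ) - (l : ℂ) + 1) *
              ∑ j ∈ Finset.Icc 1 (l - 1),
                riemannZeta ((j : ℂ) + 1) * riemannZeta ((l : ℂ) - (j : ℂ) + 1)) := by
  obtain ⟨M, rfl⟩ := Nat.exists_eq_add_of_le' hm
  -- every zeta value in the statement has an integer argument at least `2`
  have hz : ∀ (s : ℕ) (w : ℂ), w = s → 1 < s → riemannZeta w = zetaSum s := by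
    rintro s w rfl hs
    exact riemannZeta_eq_zetaSum hs
  have hF : (-1) ^ (M + 1) / (3 * ((M + 1).factorial : ℂ)) * (F₃ 0 (M + 1) : ℂ) =
      ((2 * -taylorCoeff (M + 1) 3 : ℝ) : ℂ) := by
    rw [← F₃_eq_taylorCoeff]
    push_cast; rfl
  have hEuler : ((M + 1 : ℕ) + 2 : ℂ) * riemannZeta ((M + 1 : ℕ) + 3)
      - ∑ j ∈ Icc 1 (M + 1), riemannZeta (j + 1) * riemannZeta ((M + 1 : ℕ) + 2 - j) =
      ((2 * -taylorCoeff (M + 1 + 1) 2 : ℝ) : ℂ) := by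
    rw [two_mul_neg_taylorCoeff_two, sum_Icc_one_eq_sum_range,
      hz (M + 4) _ (by push_cast; ring) (by omega)]
    push_cast
    congr 1
    refine sum_congr rfl fun i hi => ?_
    have hi' : i < M + 1 := mem_range.mp hi
    rw [hz (i + 2) _ (by push_cast; ring) (by omega), hz (M + 1 - i + 1) _ (by
      rw [Nat.cast_add, Nat.cast_sub hi'.le]; push_cast; ring) (by omega)]
  have hclosed : ((2 * -taylorCoeff (M + 1) 3 : ℝ) : ℂ) =
      ((M + 1 : ℕ) + 1 : ℂ) * ((M + 1 : ℕ) + 2) / 3 * riemannZeta ((M + 1 : ℕ) + 3)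
      - ∑ j ∈ Icc 1 (M + 1 - 1),
          ((j : ℂ) + 1) * riemannZeta (j + 2) * riemannZeta ((M + 1 : ℕ) + 1 - j)
      + 1 / ((M + 1 : ℕ) : ℂ) * ∑ l ∈ Icc 1 (M + 1 - 1),
          (((M + 1 : ℕ) : ℂ) - l) * riemannZeta ((M + 1 : ℕ) - l + 1) *
            ∑ j ∈ Icc 1 (l - 1), riemannZeta (j + 1) * riemannZeta (l - j + 1) := by
    rw [two_mul_neg_taylorCoeff_three, hz (M + 4) _ (by push_cast; ring) (by omega)]
    simp only [Nat.add_sub_cancel, sum_Icc_one_eq_sum_range]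
    push_cast
    congr 1
    · congr 1
      · ring
      · refine sum_congr rfl fun i hi => ?_
        have hi' : i < M := mem_range.mp hi
        rw [hz (i + 3) _ (by push_cast; ring) (by omega), hz (M - i + 1) _ (by
          rw [Nat.cast_add, Nat.cast_sub hi'.le]; push_cast; ring) (by omega)]
        ring
    · congr 1
      refine sum_congr rfl fun i hi => ?_
      have hi' : i < M := mem_range.mp hi
      rw [hz (M - i + 1) _ (by
        rw [Nat.cast_add, Nat.cast_sub hi'.le]; push_cast; ring) (by omega)]
      congr 1
      · ring
      · refine sum_congr rfl fun j hj => ?_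
        have hj' : j < i := mem_range.mp hj
        rw [hz (j + 2) _ (by push_cast; ring) (by omega), hz (i - j + 1) _ (by
          rw [Nat.cast_add, Nat.cast_sub hj'.le]; push_cast; ring) (by omega)]
  rw [hF, add_sub_assoc, hEuler]
  refine ⟨⟨?_, hclosed⟩, ?_, ?_⟩
  · refine (Complex.hasSum_ofReal.mpr (hasSum_harmonic_sq_sub hm)).congr_fun fun k => ?_
    push_cast; rfl
  · rw [← Complex.ofReal_add]
    refine (Complex.hasSum_ofReal.mpr (hasSum_harmonic_succ_sq_sub hm)).congr_fun fun k => ?_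
    push_cast; rfl
  -- split off `j = 1` in Euler's sum and combine the rest with the weights `j + 1`
  · rw [hclosed, ← hEuler]
    have hfirst : ∑ j ∈ Icc 1 (M + 1), riemannZeta (j + 1) * riemannZeta ((M + 1 : ℕ) + 2 - j) =
        riemannZeta 2 * riemannZeta ((M + 1 : ℕ) + 1) +
          ∑ j ∈ Icc 2 (M + 1), riemannZeta (j + 1) * riemannZeta ((M + 1 : ℕ) + 2 - j) := by
      rw [← add_sum_Ioc_eq_sum_Icc (by omega : 1 ≤ M + 1)]
      congr 1
      push_cast
      congr 2 <;> ring
    have hshift : ∑ j ∈ Icc 2 (M + 1), riemannZeta (j + 1) * riemannZeta ((M + 1 : ℕ) + 2 - j) =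
        ∑ j ∈ Icc 1 (M + 1 - 1), riemannZeta (j + 2) * riemannZeta ((M + 1 : ℕ) + 1 - j) := by
      have hIcc : Icc 2 (M + 1) = (Icc 1 M).map (addRightEmbedding 1) :=
        (map_add_right_Icc 1 M 1).symm
      rw [hIcc, sum_map]
      refine sum_congr rfl fun j _ => ?_
      rw [addRightEmbedding_apply]
      push_cast
      congr 2 <;> ring
    have hweight : ∑ j ∈ Icc 1 (M + 1 - 1),
        ((j : ℂ) + 1) * riemannZeta (j + 2) * riemannZeta ((M + 1 : ℕ) + 1 - j) =
        ∑ j ∈ Icc 1 (M + 1 - 1), (j : ℂ) * riemannZeta (j + 2) * riemannZeta ((M + 1 : ℕ) + 1 - j)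
        + ∑ j ∈ Icc 1 (M + 1 - 1), riemannZeta (j + 2) * riemannZeta ((M + 1 : ℕ) + 1 - j) := by
      rw [← sum_add_distrib]
      exact sum_congr rfl fun j _ => by ring
    rw [hfirst, hweight, ← hshift]
    ring
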